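/- Let $(M,g)$ be a compact smooth Riemannian manifold without boundary of dimension $m$, let $(N,h)$ be a smooth Riemannian manifold without boundary, and let $\alpha>1$ be a real number. For a Riemannian metric $g'$ on $M$ and a smooth map $\varphi:M\to N$ write $|d\varphi|_{g'}$ for the Hilbert--Schmidt norm of $d\varphi$ with respect to $g'$ and $h$, and put $$E(\varphi;g')=\tfrac12\int_M|d\varphi|_{g'}^2\,dV_{g'},\qquad E_\alpha(\varphi;g')=\int_M\bigl(1+|d\varphi|_{g'}^2\bigr)^{\alpha}\,dV_{g'} .$$ A smooth map $\psi:(M,g')\to(N,h)$ is called harmonic (respectively $\alpha$-harmonic) if it is a critical point of $E(\cdot\,;g')$ (respectively of $E_\alpha(\cdot\,;g')$), i.e. if for every smooth variation $(\psi_t)_{|t|<\varepsilon}$ of $\psi=\psi_0$ the derivative of the functional along $\psi_t$ at $t=0$ exists and is zero. **Theorem.** Suppose that $\psi:(M,g)\to(N,h)$ is a smooth harmonic map and that $m>2\alpha$. Then there is a smooth Riemannian metric $\bar g$ on $M$ conformally equivalent to $g$, i.e. $\bar g=\mu^2 g$ for some smooth positive function $\mu$ on $M$, such that $\psi:(M,\bar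 g)\to(N,h)$ is $\alpha$-harmonic. -/

import Mathlib

open scoped Manifold ContDiff Bundle

/-- A smooth Riemannian metric on the smooth manifold `M` of dimension `m` (without boundary). -/
abbrev SmoothMetric (m : ℕ) (M : Type*) [TopologicalSpace M]
    [ChartedSpace (EuclideanSpace ℝ (Fin m)) M] [IsManifold (𝓡 m) ∞ M] :=
  Bundle.ContMDiffRiemannianMetric (𝓡 m) ∞ (EuclideanSpace ℝ (Fin m))
    (fun x : M => TangentSpace (𝓡 m) x)

noncomputable section

section Coordinates

variable {m n : ℕ}
  {M : Type*} [TopologicalSpace M] [ChartedSpace (EuclideanSpace ℝ (Fin m)) M]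
  [IsManifold (𝓡 m) ∞ M]
  {N : Type*} [TopologicalSpace N] [ChartedSpace (EuclideanSpace ℝ (Fin n)) N]
  [IsManifold (𝓡 n) ∞ N]

/-- The preferred chart `φ` around `c`, with values in `ℝᵐ`. -/
abbrev chartMap (m : ℕ) {M : Type*} [TopologicalSpace M]
    [ChartedSpace (EuclideanSpace ℝ (Fin m)) M] (c : M) :
    OpenPartialHomeomorph M (EuclideanSpace ℝ (Fin m)) :=
  chartAt (EuclideanSpace ℝ (Fin m)) c

/-- The coordinate vector `∂ᵢ = d(φ⁻¹)_y(eᵢ)` at the point `φ⁻¹(y)`, where `φ` is the chart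
around `c`. -/
def coordVector (c : M) (y : EuclideanSpace ℝ (Fin m)) (i : Fin m) :
    TangentSpace (𝓡 m) ((chartMap m c).symm y) :=
  mfderiv (𝓡 m) (𝓡 m) (chartMap m c).symm y (EuclideanSpace.single i (1 : ℝ))

/-- The matrix `g_{ij}(y) = g(∂ᵢ, ∂ⱼ)` of the metric `g` in the chart around `c`. -/
def metricMatrix (g : SmoothMetric m M) (c : M) (y : EuclideanSpace ℝ (Fin m)) :
    Matrix (Fin m) (Fin m) ℝ :=
  Matrix.of fun i j =>
    g.inner ((chartMap m c).symm y) (coordVector c y i) (coordVector c y j)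

/-- The matrix `(ψ^*h)_{ij}(y) = h(dψ(∂ᵢ), dψ(∂ⱼ))` of the pulled back metric in the chart
around `c`. -/
def pullbackMatrix (h : SmoothMetric n N) (ψ : M → N) (c : M)
    (y : EuclideanSpace ℝ (Fin m)) : Matrix (Fin m) (Fin m) ℝ :=
  Matrix.of fun i j =>
    h.inner (ψ ((chartMap m c).symm y))
      (mfderiv (𝓡 m) (𝓡 n) ψ ((chartMap m c).symm y) (coordVector c y i))
      (mfderiv (𝓡 m) (𝓡 n) ψ ((chartMap m c).symm y) (coordVector c y j))

/-- The squared Hilbert-Schmidt norm `|dψ|²` of the differential of `ψ` at `x` with respect to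
`g` and `h`: in coordinates around `x` it is `∑ g^{ij} h(dψ(∂ᵢ), dψ(∂ⱼ))`, that is, the trace
of `ψ^*h` with respect to `g`. -/
def dNormSq (g : SmoothMetric m M) (h : SmoothMetric n N) (ψ : M → N) (x : M) : ℝ :=
  Matrix.trace ((metricMatrix g x (chartMap m x x))⁻¹ * pullbackMatrix h ψ x (chartMap m x x))

/-- The metrics `g` and `g'` are conformally equivalent: `g' = μ² g` for a smooth positive
function `μ`. -/
def ConformallyEquivalent (g g' : SmoothMetric m M) : Prop :=
  ∃ μ : M → ℝ, ContMDiff (𝓡 m) 𝓘(ℝ, ℝ) ∞ μ ∧ (∀ x, 0 < μ x) ∧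
    ∀ (x : M) (v w : TangentSpace (𝓡 m) x), g'.inner x v w = μ x ^ 2 * g.inner x v w

/-- The Riemannian volume on the domain of the chart `φ` around `c`, as a measure on `M`: the
image under `φ⁻¹` of the measure `√(det g_{ij}) dy` on the range of `φ`. -/
def chartVolume [MeasurableSpace M] (g : SmoothMetric m M) (c : M) :
    MeasureTheory.Measure M :=
  ((MeasureTheory.volume.restrict (chartMap m c).target).withDensity
    fun y => ENNReal.ofReal (Real.sqrt (metricMatrix g c y).det)).map (chartMap m c).symm

end Coordinates

section Compact

variable {m n : ℕ}
  {M : Type*} [TopologicalSpace M] [ChartedSpace (EuclideanSpace ℝ (Fin m)) M]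
  [IsManifold (𝓡 m) ∞ M] [T2Space M] [CompactSpace M]
  {N : Type*} [TopologicalSpace N] [ChartedSpace (EuclideanSpace ℝ (Fin n)) N]
  [IsManifold (𝓡 n) ∞ N]

/-- A smooth partition of unity on `M` subordinate to the domains of the charts. -/
def chartPartition (m : ℕ) (M : Type*) [TopologicalSpace M]
    [ChartedSpace (EuclideanSpace ℝ (Fin m)) M] [IsManifold (𝓡 m) ∞ M] [T2Space M]
    [CompactSpace M] : SmoothPartitionOfUnity M (𝓡 m) M Set.univ :=
  (SmoothPartitionOfUnity.exists_isSubordinate_chartAt_source (I := 𝓡 m) (M := M)).choose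

theorem chartPartition_isSubordinate :
    (chartPartition m M).IsSubordinate
      fun c => (chartAt (EuclideanSpace ℝ (Fin m)) c).source :=
  (SmoothPartitionOfUnity.exists_isSubordinate_chartAt_source (I := 𝓡 m) (M := M)).choose_spec

/-- The Riemannian volume measure `dV_g` of the compact manifold `(M, g)`, glued from the
volumes in the charts by a partition of unity. -/
def riemannianVolume [MeasurableSpace M] (g : SmoothMetric m M) : MeasureTheory.Measure M :=
  MeasureTheory.Measure.sum fun c : M =>
    (chartVolume g c).withDensity fun x => ENNReal.ofReal (chartPartition m M c x)

/-- The energy `E(ψ) = ½ ∫_M |dψ|² dV_g`. -/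
def energy [MeasurableSpace M] (g : SmoothMetric m M) (h : SmoothMetric n N)
    (ψ : M → N) : ℝ :=
  1 / 2 * ∫ x, dNormSq g h ψ x ∂(riemannianVolume g)

/-- The `α`-energy `E_α(ψ) = ∫_M (1 + |dψ|²)^α dV_g`. -/
def alphaEnergy [MeasurableSpace M] (α : ℝ) (g : SmoothMetric m M) (h : SmoothMetric n N)
    (ψ : M → N) : ℝ :=
  ∫ x, (1 + dNormSq g h ψ x) ^ α ∂(riemannianVolume g)

end Compact

/-- `F` is a smooth variation `(ψ_t)`, `|t| < ε`, of the map `ψ = ψ_0`. -/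
def IsSmoothVariation (m n : ℕ)
    {M : Type*} [TopologicalSpace M] [ChartedSpace (EuclideanSpace ℝ (Fin m)) M]
    {N : Type*} [TopologicalSpace N] [ChartedSpace (EuclideanSpace ℝ (Fin n)) N]
    (ψ : M → N) (ε : ℝ) (F : ℝ → M → N) : Prop :=
  F 0 = ψ ∧
    ContMDiffOn (𝓘(ℝ, ℝ).prod (𝓡 m)) (𝓡 n) ∞ (fun p : ℝ × M => F p.1 p.2)
      (Set.Ioo (-ε) ε ×ˢ Set.univ)

/-- `ψ` is a smooth map that is a critical point of the functional `Φ`: the derivative of `Φ`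
along every smooth variation of `ψ` vanishes. -/
def IsCriticalMap (m n : ℕ)
    {M : Type*} [TopologicalSpace M] [ChartedSpace (EuclideanSpace ℝ (Fin m)) M]
    {N : Type*} [TopologicalSpace N] [ChartedSpace (EuclideanSpace ℝ (Fin n)) N]
    (Φ : (M → N) → ℝ) (ψ : M → N) : Prop :=
  ContMDiff (𝓡 m) (𝓡 n) ∞ ψ ∧
    ∀ (ε : ℝ) (F : ℝ → M → N), 0 < ε → IsSmoothVariation m n ψ ε F →
      HasDerivAt (fun t => Φ (F t)) 0 0

section Harmonic

variable {m n : ℕ}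
  {M : Type*} [TopologicalSpace M] [ChartedSpace (EuclideanSpace ℝ (Fin m)) M]
  [IsManifold (𝓡 m) ∞ M] [T2Space M] [CompactSpace M] [MeasurableSpace M]
  {N : Type*} [TopologicalSpace N] [ChartedSpace (EuclideanSpace ℝ (Fin n)) N]
  [IsManifold (𝓡 n) ∞ N]

/-- Harmonic maps `(M, g) → (N, h)`: the critical points of the energy. -/
def IsHarmonicMap (g : SmoothMetric m M) (h : SmoothMetric n N) (ψ : M → N) : Prop :=
  IsCriticalMap m n (energy g h) ψ

/-- `α`-harmonic maps `(M, g) → (N, h)`: the critical points of the `α`-energy. -/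
def IsAlphaHarmonicMap (α : ℝ) (g : SmoothMetric m M) (h : SmoothMetric n N)
    (ψ : M → N) : Prop :=
  IsCriticalMap m n (alphaEnergy α g h) ψ

end Harmonic

end

/-!
The proof looks for `μ` as a function of the energy density `e = |dψ|²_g`. For `g' = μ² g` one has
`|dφ|²_{g'} = μ⁻² |dφ|²_g` and `dV_{g'} = μᵐ dV_g`, so that
`E_α(φ; g') = ∫ μᵐ (1 + μ⁻² |dφ|²_g)^α dV_g` (`alphaEnergy_conformal`). Differentiating along a
variation `ψ_t` gives
`α ∫ μ^(m-2) (1 + μ⁻² e)^(α-1) ∂_t|_{t=0} |dψ_t|²_g dV_g`,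
which, up to a constant factor, is the first variation of the energy of `(M, g)` with the weight
`μ^(m-2) (1 + μ⁻² e)^(α-1)` under the integral.
If the weight is identically `1`, harmonicity of `ψ` for `g` makes the integral vanish.

It remains to solve `μ^(m-2) (1 + μ⁻² e)^(α-1) = 1` for `μ`. With `μ² = exp u` and
`γ = (m - 2α) / (2(α - 1))` the equation becomes `exp (-γu) - exp u = e`. Since `m > 2α`, `γ` is
positive, the left-hand side is a decreasing diffeomorphism of `ℝ`, and `u` is a smooth function
of `e` (`exists_conformalFactor`).

Three facts make this rigorous. The energy density does not depend on the chart used to compute it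
(`dNormSq_eq_trace`), hence it is a smooth function on `M` (`contMDiff_dNormSq`). Along a variation
it has a time derivative that is jointly continuous (`IsSmoothVariation.exists_hasDerivAt_dNormSq`).
The Riemannian volume is finite (`isFiniteMeasure_riemannianVolume`), which allows differentiation
under the integral sign (`hasDerivAt_integral_of_continuousOn`), for the energy as well as for the
`α`-energy.
-/

open Set MeasureTheory
open scoped Matrix

/-! ### Traces and change of frame -/

/-- The trace of one bilinear form with respect to another does not depend on the frame. -/
theorem Matrix.trace_inv_mul_congr {ι : Type*} [Fintype ι] [DecidableEq ι]
    (S G P : Matrix ι ι ℝ) (hS : IsUnit S.det) :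
    ((Sᵀ * G * S)⁻¹ * (Sᵀ * P * S)).trace = (G⁻¹ * P).trace := by
  have hS' : IsUnit Sᵀ.det := by rwa [Matrix.det_transpose]
  have h : (Sᵀ * G * S)⁻¹ * (Sᵀ * P * S) = S⁻¹ * (G⁻¹ * P * S) := by
    rw [Matrix.mul_inv_rev, Matrix.mul_inv_rev]
    simp only [Matrix.mul_assoc]
    rw [Matrix.nonsing_inv_mul_cancel_left _ _ hS']
  rw [h, Matrix.trace_mul_comm, Matrix.mul_assoc, Matrix.mul_nonsing_inv _ hS, Matrix.mul_one]

/-- The Gram matrix of a bilinear form transforms by congruence under a change of frame. -/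
theorem Matrix.gram_sum_smul {ι V : Type*} [Fintype ι] [AddCommGroup V] [Module ℝ V]
    [TopologicalSpace V] [IsTopologicalAddGroup V] [ContinuousConstSMul ℝ V]
    (B : V →L[ℝ] V →L[ℝ] ℝ) (v : ι → V) (S : Matrix ι ι ℝ) :
    (Matrix.of fun i j => B (∑ k, S k i • v k) (∑ l, S l j • v l)) =
      S.transpose * (Matrix.of fun i j => B (v i) (v j)) * S := by
  ext i j
  simp only [Matrix.of_apply, map_sum, map_smul, _root_.sum_apply, _root_.smul_apply,
    Matrix.mul_apply, Matrix.transpose_apply, smul_eq_mul, Finset.sum_mul, Finset.mul_sum]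
  refine Finset.sum_congr rfl fun k _ => Finset.sum_congr rfl fun l _ => ?_
  ring

section Frames

variable {m n : ℕ}
  {M : Type*} [TopologicalSpace M] [ChartedSpace (EuclideanSpace ℝ (Fin m)) M]
  {N : Type*} [TopologicalSpace N] [ChartedSpace (EuclideanSpace ℝ (Fin n)) N]
  [IsManifold (𝓡 n) ∞ N]

/-- The coordinate frame at `p` of the chart around `c`. It is `coordVector` at the coordinates
of `p`, regarded as a family of vectors tangent at `p` itself. -/
noncomputable def coordFrame (c p : M) (i : Fin m) : TangentSpace (𝓡 m) p :=
  (mfderiv (𝓡 m) (𝓡 m) (chartMap m c).symm (chartMap m c p) (EuclideanSpace.single i (1 : ℝ)) :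
    EuclideanSpace ℝ (Fin m))

theorem pullbackMatrix_chartMap (h : SmoothMetric n N) (ψ : M → N) {c p : M}
    (hp : p ∈ (chartMap m c).source) :
    pullbackMatrix h ψ c (chartMap m c p) =
      Matrix.of fun i j => h.inner (ψ p) (mfderiv (𝓡 m) (𝓡 n) ψ p (coordFrame c p i))
        (mfderiv (𝓡 m) (𝓡 n) ψ p (coordFrame c p j)) := by
  have key : ∀ (q : M) (_ : q = p) (v w : EuclideanSpace ℝ (Fin m)),
      h.inner (ψ q) (mfderiv (𝓡 m) (𝓡 n) ψ q v) (mfderiv (𝓡 m) (𝓡 n) ψ q w) =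
      h.inner (ψ p) (mfderiv (𝓡 m) (𝓡 n) ψ p v) (mfderiv (𝓡 m) (𝓡 n) ψ p w) := by
    rintro q rfl v w; rfl
  ext i j
  exact key _ ((chartMap m c).left_inv hp) _ _

variable [IsManifold (𝓡 m) ∞ M]

theorem chartMap_mdifferentiable (c : M) :
    (chartMap m c).MDifferentiable (𝓡 m) (𝓡 m) :=
  haveI : IsManifold (𝓡 m) 1 M := IsManifold.of_le (n := ∞) (by simp)
  mdifferentiable_chart c

theorem metricMatrix_chartMap (g : SmoothMetric m M) {c p : M} (hp : p ∈ (chartMap m c).source) :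
    metricMatrix g c (chartMap m c p) =
      Matrix.of fun i j => g.inner p (coordFrame c p i) (coordFrame c p j) := by
  have key : ∀ (q : M) (_ : q = p) (v w : EuclideanSpace ℝ (Fin m)),
      g.inner q v w = g.inner p v w := by
    rintro q rfl v w; rfl
  ext i j
  exact key _ ((chartMap m c).left_inv hp) _ _

/-- The change of coordinate frames is invertible: every frame vector of one chart expands in
the frame of another. -/
theorem exists_coordFrame_eq_sum (c c' p : M) (hp : p ∈ (chartMap m c).source) :
    ∃ S : Matrix (Fin m) (Fin m) ℝ,
      ∀ i, coordFrame (m := m) c' p i = ∑ k, S k i • coordFrame c p k := by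
  set A := mfderiv (𝓡 m) (𝓡 m) (chartMap m c).symm (chartMap m c p)
  set B := mfderiv (𝓡 m) (𝓡 m) (chartMap m c) p
  have hAB : A.comp B = ContinuousLinearMap.id _ _ :=
    (chartMap_mdifferentiable c).symm_comp_deriv hp
  let A' : EuclideanSpace ℝ (Fin m) →L[ℝ] EuclideanSpace ℝ (Fin m) := A
  let b : Fin m → EuclideanSpace ℝ (Fin m) := fun i => B (coordFrame c' p i)
  refine ⟨Matrix.of fun k i => b i k, fun i => ?_⟩
  have h1 : coordFrame (m := m) c' p i = A' (b i) :=
    (congrArg (fun T => T (coordFrame c' p i)) hAB).symm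
  rw [h1, ← (EuclideanSpace.basisFun (Fin m) ℝ).sum_repr (b i), map_sum]
  refine Finset.sum_congr rfl fun k _ => ?_
  rw [map_smul, EuclideanSpace.basisFun_apply, EuclideanSpace.basisFun_repr]
  rfl

theorem coordFrame_sum_eq_zero {c p : M} (hp : p ∈ (chartMap m c).source) (a : Fin m → ℝ)
    (ha : ∑ k, a k • coordFrame (m := m) c p k = 0) : a = 0 := by
  have hinj : Function.Injective
      (mfderiv (𝓡 m) (𝓡 m) (chartMap m c).symm (chartMap m c p)) :=
    (chartMap_mdifferentiable c).symm.mfderiv_injective ((chartMap m c).map_source hp)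
  let A' : EuclideanSpace ℝ (Fin m) →L[ℝ] EuclideanSpace ℝ (Fin m) :=
    mfderiv (𝓡 m) (𝓡 m) (chartMap m c).symm (chartMap m c p)
  have h0 : A' (∑ k, a k • EuclideanSpace.single k (1 : ℝ)) = A' 0 := by
    rw [map_sum, map_zero]
    refine Eq.trans (Finset.sum_congr rfl fun k _ => ?_) ha
    rw [map_smul]; rfl
  have h1 := hinj h0
  funext j
  have h2 := congrArg (fun w : EuclideanSpace ℝ (Fin m) => w j) h1
  simpa [Finset.sum_apply, Pi.single_apply] using h2

theorem metricMatrix_posDef (g : SmoothMetric m M) {c : M} {y : EuclideanSpace ℝ (Fin m)}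
    (hy : y ∈ (chartMap m c).target) : (metricMatrix g c y).PosDef := by
  have hp := (chartMap m c).map_target hy
  rw [← (chartMap m c).right_inv hy, metricMatrix_chartMap g hp]
  set p := (chartMap m c).symm y
  refine Matrix.PosDef.of_dotProduct_mulVec_pos ?_ fun a ha => ?_
  · ext i j
    exact g.symm p _ _
  · have hne : ∑ k, a k • coordFrame (m := m) c p k ≠ 0 := fun h =>
      ha (coordFrame_sum_eq_zero hp a h)
    refine lt_of_lt_of_eq (g.pos p _ hne) ?_
    simp only [map_sum, map_smul, sum_apply, smul_apply,
      smul_eq_mul, dotProduct, Matrix.mulVec, Matrix.of_apply, star_trivial, Finset.mul_sum]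
    rw [Finset.sum_comm]
    refine Finset.sum_congr rfl fun k _ => Finset.sum_congr rfl fun l _ => ?_
    ring

theorem metricMatrix_det_pos (g : SmoothMetric m M) {c : M} {y : EuclideanSpace ℝ (Fin m)}
    (hy : y ∈ (chartMap m c).target) : 0 < (metricMatrix g c y).det :=
  (metricMatrix_posDef g hy).det_pos

/-- `|dψ|²` can be computed in any chart, not only in the preferred chart around the point. -/
theorem dNormSq_eq_trace (g : SmoothMetric m M) (h : SmoothMetric n N) (ψ : M → N) {c p : M}
    (hp : p ∈ (chartMap m c).source) :
    dNormSq g h ψ p = Matrix.trace ((metricMatrix g c (chartMap m c p))⁻¹ *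
      pullbackMatrix h ψ c (chartMap m c p)) := by
  have hp' : p ∈ (chartMap m p).source := mem_chart_source _ p
  obtain ⟨S, hS⟩ := exists_coordFrame_eq_sum c p p hp
  have hG : metricMatrix g p (chartMap m p p) =
      S.transpose * metricMatrix g c (chartMap m c p) * S := by
    rw [metricMatrix_chartMap g hp, metricMatrix_chartMap g hp']
    simp only [hS]
    exact Matrix.gram_sum_smul (g.inner p) _ S
  have hP : pullbackMatrix h ψ p (chartMap m p p) =
      S.transpose * pullbackMatrix h ψ c (chartMap m c p) * S := by
    rw [pullbackMatrix_chartMap h ψ hp, pullbackMatrix_chartMap h ψ hp']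
    simp only [hS, map_sum, map_smul]
    simp only [← map_smul, ← map_sum]
    have := Matrix.gram_sum_smul (h.inner (ψ p))
      (fun k => mfderiv (𝓡 m) (𝓡 n) ψ p (coordFrame c p k)) S
    simpa only [map_sum, map_smul] using this
  have hdet : IsUnit S.det := by
    have := metricMatrix_det_pos g ((chartMap m p).map_source hp')
    rw [hG, Matrix.det_mul] at this
    exact (right_ne_zero_of_mul this.ne').isUnit
  rw [dNormSq, hG, hP, Matrix.trace_inv_mul_congr _ _ _ hdet]

end Frames

/-! ### Smooth dependence of the energy density on time and position -/

section Smoothness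

variable {m n : ℕ}
  {N : Type*} [TopologicalSpace N] [ChartedSpace (EuclideanSpace ℝ (Fin n)) N]
  {M : Type*} [TopologicalSpace M] [ChartedSpace (EuclideanSpace ℝ (Fin m)) M]

theorem IsSmoothVariation.contMDiff {ψ : M → N} {ε : ℝ} {F : ℝ → M → N}
    (hF : IsSmoothVariation m n ψ ε F) {t : ℝ} (ht : t ∈ Ioo (-ε) ε) :
    ContMDiff (𝓡 m) (𝓡 n) ∞ (F t) := by
  rw [← contMDiffOn_univ]
  exact hF.2.comp (f := fun x : M => (t, x))
    (contMDiff_const.prodMk contMDiff_id).contMDiffOn fun x _ => ⟨ht, mem_univ _⟩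

theorem isSmoothVariation_const {ψ : M → N} (hψ : ContMDiff (𝓡 m) (𝓡 n) ∞ ψ) (ε : ℝ) :
    IsSmoothVariation m n ψ ε fun _ => ψ :=
  ⟨rfl, (hψ.comp contMDiff_snd).contMDiffOn⟩

variable [IsManifold (𝓡 m) ∞ M]

/-- A smooth variation, read in the chart around `c` in the domain. -/
theorem IsSmoothVariation.contMDiffOn_chart {ψ : M → N} {ε : ℝ} {F : ℝ → M → N}
    (hF : IsSmoothVariation m n ψ ε F) (c : M) :
    ContMDiffOn 𝓘(ℝ, ℝ × EuclideanSpace ℝ (Fin m)) (𝓡 n) ∞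
      (fun p : ℝ × EuclideanSpace ℝ (Fin m) => F p.1 ((chartMap m c).symm p.2))
      (Ioo (-ε) ε ×ˢ (chartMap m c).target) := by
  refine hF.2.comp (f := fun p : ℝ × EuclideanSpace ℝ (Fin m) =>
    (p.1, (chartMap m c).symm p.2)) (ContMDiffOn.prodMk ?_ ?_) fun p hp => ⟨hp.1, mem_univ _⟩
  · exact contDiff_fst.contMDiff.contMDiffOn
  · exact (contMDiffOn_chart_symm (I := 𝓡 m) (n := ∞)).comp
      contDiff_snd.contMDiff.contMDiffOn fun p hp => hp.2

variable [IsManifold (𝓡 n) ∞ N]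

/-- For a smooth map `Φ` from a vector space, `h(dΦ(v), dΦ(w))` depends smoothly on the point. -/
theorem contDiffOn_inner_mfderiv {V : Type*} [NormedAddCommGroup V] [NormedSpace ℝ V]
    (h : SmoothMetric n N) {Φ : V → N} {s : Set V} (hs : IsOpen s)
    (hΦ : ContMDiffOn 𝓘(ℝ, V) (𝓡 n) ∞ Φ s) (v w : V) :
    ContDiffOn ℝ ∞ (fun p => h.inner (Φ p) (mfderiv 𝓘(ℝ, V) (𝓡 n) Φ p v)
      (mfderiv 𝓘(ℝ, V) (𝓡 n) Φ p w)) s := by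
  have htan : ∀ u : V, ContMDiffOn 𝓘(ℝ, V) (𝓡 n).tangent ∞
      (fun p => (⟨Φ p, mfderiv 𝓘(ℝ, V) (𝓡 n) Φ p u⟩ : TangentBundle (𝓡 n) N)) s := by
    intro u
    have h1 := hΦ.contMDiffOn_tangentMapWithin (m := ∞) (by simp) hs.uniqueMDiffOn
    have h2 : ContMDiffOn 𝓘(ℝ, V) 𝓘(ℝ, V).tangent ∞
        (fun p => (⟨p, u⟩ : TangentBundle 𝓘(ℝ, V) V)) s :=
      contMDiffOn_vectorSpace_iff_contDiffOn.2 contDiffOn_const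
    refine (h1.comp h2 fun p hp => hp).congr fun p hp => ?_
    simp only [Function.comp_apply, tangentMapWithin]
    rw [mfderivWithin_of_isOpen hs hp]
  rw [← contMDiffOn_iff_contDiffOn]
  intro p hp
  have key : ContMDiffWithinAt 𝓘(ℝ, V) ((𝓡 n).prod 𝓘(ℝ)) ∞
      (fun q ↦ Bundle.TotalSpace.mk' ℝ (E := Bundle.Trivial N ℝ) (Φ q)
        (h.inner (Φ q) (mfderiv 𝓘(ℝ, V) (𝓡 n) Φ q v) (mfderiv 𝓘(ℝ, V) (𝓡 n) Φ q w))) s p := by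
    apply ContMDiffWithinAt.clm_bundle_apply₂ (F₁ := EuclideanSpace ℝ (Fin n))
      (F₂ := EuclideanSpace ℝ (Fin n))
    · exact ContMDiffAt.comp_contMDiffWithinAt p h.contMDiff.contMDiffAt (hΦ p hp)
    · exact htan v p hp
    · exact htan w p hp
  simp only [Bundle.contMDiffWithinAt_totalSpace] at key
  exact key.2

/-- The components of `(ψ_t)^* h` are expressed through the differential of the map
`(t, y) ↦ ψ_t(φ⁻¹(y))`, in which the time and the coordinates enter jointly. -/
theorem IsSmoothVariation.pullbackMatrix_apply (h : SmoothMetric n N) {ψ : M → N} {ε : ℝ}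
    {F : ℝ → M → N} (hF : IsSmoothVariation m n ψ ε F) (c : M)
    {p : ℝ × EuclideanSpace ℝ (Fin m)} (hp : p ∈ Ioo (-ε) ε ×ˢ (chartMap m c).target)
    (i j : Fin m) :
    pullbackMatrix h (F p.1) c p.2 i j =
      (fun Φ : ℝ × EuclideanSpace ℝ (Fin m) → N => h.inner (Φ p)
        (mfderiv 𝓘(ℝ, ℝ × EuclideanSpace ℝ (Fin m)) (𝓡 n) Φ p
          (0, EuclideanSpace.single i (1 : ℝ)))
        (mfderiv 𝓘(ℝ, ℝ × EuclideanSpace ℝ (Fin m)) (𝓡 n) Φ p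
          (0, EuclideanSpace.single j (1 : ℝ))))
        (fun q => F q.1 ((chartMap m c).symm q.2)) := by
  obtain ⟨t, y⟩ := p
  set Φ : ℝ × EuclideanSpace ℝ (Fin m) → N := fun q => F q.1 ((chartMap m c).symm q.2)
  have hΦ : MDifferentiableAt 𝓘(ℝ, ℝ × EuclideanSpace ℝ (Fin m)) (𝓡 n) Φ (t, y) :=
    ((hF.contMDiffOn_chart c).contMDiffAt
      ((isOpen_Ioo.prod (chartMap m c).open_target).mem_nhds hp)).mdifferentiableAt (by simp)
  have hFt : MDifferentiableAt (𝓡 m) (𝓡 n) (F t) ((chartMap m c).symm y) :=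
    (hF.contMDiff hp.1).mdifferentiable (by simp) _
  have hinc : HasFDerivAt (fun y : EuclideanSpace ℝ (Fin m) => (t, y))
      (ContinuousLinearMap.inr ℝ ℝ (EuclideanSpace ℝ (Fin m))) y :=
    hasFDerivAt_prodMk_right t y
  have key : (mfderiv (𝓡 m) (𝓡 n) (F t) ((chartMap m c).symm y)).comp
      (mfderiv (𝓡 m) (𝓡 m) (chartMap m c).symm y) =
      (mfderiv 𝓘(ℝ, ℝ × EuclideanSpace ℝ (Fin m)) (𝓡 n) Φ (t, y)).comp
        (ContinuousLinearMap.inr ℝ ℝ (EuclideanSpace ℝ (Fin m))) := by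
    rw [← mfderiv_comp y hFt ((chartMap_mdifferentiable c).mdifferentiableAt_symm hp.2)]
    exact (hΦ.hasMFDerivAt.comp y hinc.hasMFDerivAt).mfderiv
  have hv : ∀ k, mfderiv (𝓡 m) (𝓡 n) (F t) ((chartMap m c).symm y) (coordVector c y k) =
      mfderiv 𝓘(ℝ, ℝ × EuclideanSpace ℝ (Fin m)) (𝓡 n) Φ (t, y)
        (0, EuclideanSpace.single k (1 : ℝ)) := fun k =>
    congrArg (fun T => T (EuclideanSpace.single k (1 : ℝ))) key
  simp only [pullbackMatrix, Matrix.of_apply]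
  rw [hv i, hv j]

theorem IsSmoothVariation.contDiffOn_pullbackMatrix (h : SmoothMetric n N) {ψ : M → N} {ε : ℝ}
    {F : ℝ → M → N} (hF : IsSmoothVariation m n ψ ε F) (c : M) (i j : Fin m) :
    ContDiffOn ℝ ∞ (fun p : ℝ × EuclideanSpace ℝ (Fin m) => pullbackMatrix h (F p.1) c p.2 i j)
      (Ioo (-ε) ε ×ˢ (chartMap m c).target) :=
  (contDiffOn_inner_mfderiv h (isOpen_Ioo.prod (chartMap m c).open_target)
    (hF.contMDiffOn_chart c) _ _).congr fun _ hp => hF.pullbackMatrix_apply h c hp i j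

/-- The matrix of `g` is that of the pullback of `g` by the identity, so that its smoothness is a
case of the smoothness of pullbacks. -/
theorem pullbackMatrix_id (g : SmoothMetric m M) (c : M) (y : EuclideanSpace ℝ (Fin m)) :
    pullbackMatrix g id c y = metricMatrix g c y := by
  ext i j
  simp only [pullbackMatrix, metricMatrix, Matrix.of_apply, mfderiv_id]
  rfl

theorem contDiffOn_metricMatrix (g : SmoothMetric m M) (c : M) (i j : Fin m) :
    ContDiffOn ℝ ∞ (fun y => metricMatrix g c y i j) (chartMap m c).target := by
  have h1 := (isSmoothVariation_const (n := m) (contMDiff_id (I := 𝓡 m) (M := M))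
    1).contDiffOn_pullbackMatrix g c i j
  simp only [pullbackMatrix_id] at h1
  exact h1.comp (f := fun y => ((0 : ℝ), y)) (contDiff_const.prodMk contDiff_id).contDiffOn
    fun y hy => ⟨by simp, hy⟩

theorem contDiffOn_det {ι V : Type*} [Fintype ι] [DecidableEq ι] [NormedAddCommGroup V]
    [NormedSpace ℝ V] {A : V → Matrix ι ι ℝ} {s : Set V}
    (hA : ∀ i j, ContDiffOn ℝ ∞ (fun v => A v i j) s) :
    ContDiffOn ℝ ∞ (fun v => (A v).det) s := by
  simp only [Matrix.det_apply]
  exact ContDiffOn.sum fun σ _ => (contDiffOn_prod fun i _ => hA _ _).const_smul _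

theorem contDiffOn_matrix_inv {ι V : Type*} [Fintype ι] [DecidableEq ι] [NormedAddCommGroup V]
    [NormedSpace ℝ V] {A : V → Matrix ι ι ℝ} {s : Set V}
    (hA : ∀ i j, ContDiffOn ℝ ∞ (fun v => A v i j) s) (hdet : ∀ v ∈ s, (A v).det ≠ 0)
    (i j : ι) : ContDiffOn ℝ ∞ (fun v => (A v)⁻¹ i j) s := by
  simp only [Matrix.inv_def, Matrix.smul_apply, Ring.inverse_eq_inv', smul_eq_mul,
    Matrix.adjugate_apply]
  refine ((contDiffOn_det hA).inv hdet).mul (contDiffOn_det fun k l => ?_)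
  by_cases hk : k = j
  · subst hk
    simpa using contDiffOn_const
  · simpa [Matrix.updateRow_apply, hk] using hA k l

/-- The energy density in the chart around `c`. -/
noncomputable def chartDensity (g : SmoothMetric m M) (h : SmoothMetric n N) (ψ : M → N) (c : M)
    (y : EuclideanSpace ℝ (Fin m)) : ℝ :=
  Matrix.trace ((metricMatrix g c y)⁻¹ * pullbackMatrix h ψ c y)

theorem IsSmoothVariation.contDiffOn_chartDensity (g : SmoothMetric m M) (h : SmoothMetric n N)
    {ψ : M → N} {ε : ℝ} {F : ℝ → M → N} (hF : IsSmoothVariation m n ψ ε F) (c : M) :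
    ContDiffOn ℝ ∞ (fun p : ℝ × EuclideanSpace ℝ (Fin m) => chartDensity g h (F p.1) c p.2)
      (Ioo (-ε) ε ×ˢ (chartMap m c).target) := by
  simp only [chartDensity, Matrix.trace, Matrix.diag_apply, Matrix.mul_apply]
  refine ContDiffOn.sum fun i _ => ContDiffOn.sum fun j _ =>
    ContDiffOn.mul ?_ (hF.contDiffOn_pullbackMatrix h c j i)
  exact (contDiffOn_matrix_inv (contDiffOn_metricMatrix g c)
    (fun y hy => (metricMatrix_det_pos g hy).ne') i j).comp contDiff_snd.contDiffOn
    fun p hp => hp.2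

theorem contMDiff_dNormSq (g : SmoothMetric m M) (h : SmoothMetric n N) {ψ : M → N}
    (hψ : ContMDiff (𝓡 m) (𝓡 n) ∞ ψ) : ContMDiff (𝓡 m) 𝓘(ℝ, ℝ) ∞ (dNormSq g h ψ) := by
  intro x
  have h1 := (isSmoothVariation_const hψ 1).contDiffOn_chartDensity g h x
  have h2 : ContDiffOn ℝ ∞ (chartDensity g h ψ x) (chartMap m x).target :=
    h1.comp (f := fun y => ((0 : ℝ), y)) (contDiff_const.prodMk contDiff_id).contDiffOn
      fun y hy => ⟨by simp, hy⟩
  have h3 : ContMDiffOn (𝓡 m) 𝓘(ℝ, ℝ) ∞ (dNormSq g h ψ) (chartMap m x).source :=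
    (h2.contMDiffOn.comp (contMDiffOn_chart (I := 𝓡 m) (n := ∞))
      fun y hy => (chartMap m x).map_source hy).congr fun y hy => dNormSq_eq_trace g h ψ hy
  exact h3.contMDiffAt ((chartMap m x).open_source.mem_nhds (mem_chart_source _ x))

/-- Along a smooth variation the energy density is differentiable in the time, and its time
derivative is continuous in the time and the point together. -/
theorem IsSmoothVariation.exists_hasDerivAt_dNormSq (g : SmoothMetric m M)
    (h : SmoothMetric n N) {ψ : M → N} {ε : ℝ} {F : ℝ → M → N}
    (hF : IsSmoothVariation m n ψ ε F) :
    ∃ e' : ℝ → M → ℝ,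
      ContinuousOn (fun p : ℝ × M => e' p.1 p.2) (Ioo (-ε) ε ×ˢ univ) ∧
      ContinuousOn (fun p : ℝ × M => dNormSq g h (F p.1) p.2) (Ioo (-ε) ε ×ˢ univ) ∧
      ∀ t ∈ Ioo (-ε) ε, ∀ x, HasDerivAt (fun s => dNormSq g h (F s) x) (e' t x) t := by
  -- In the chart around `c`, the time derivative is the derivative in the direction `(1, 0)`.
  set D : M → ℝ × EuclideanSpace ℝ (Fin m) → ℝ := fun c p => chartDensity g h (F p.1) c p.2
  have hD : ∀ c, ContDiffOn ℝ ∞ (D c) (Ioo (-ε) ε ×ˢ (chartMap m c).target) :=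
    hF.contDiffOn_chartDensity g h
  have hopen : ∀ c : M, IsOpen (Ioo (-ε) ε ×ˢ (chartMap m c).target) := fun c =>
    isOpen_Ioo.prod (chartMap m c).open_target
  have hderiv : ∀ c, ∀ t ∈ Ioo (-ε) ε, ∀ x ∈ (chartMap m c).source,
      HasDerivAt (fun s => dNormSq g h (F s) x)
        (fderiv ℝ (D c) (t, chartMap m c x) (1, 0)) t := by
    intro c t ht x hx
    have hmem : (t, chartMap m c x) ∈ Ioo (-ε) ε ×ˢ (chartMap m c).target :=
      ⟨ht, (chartMap m c).map_source hx⟩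
    have h1 : HasFDerivAt (D c) (fderiv ℝ (D c) (t, chartMap m c x)) (t, chartMap m c x) :=
      (((hD c).contDiffAt ((hopen c).mem_nhds hmem)).differentiableAt (by simp)).hasFDerivAt
    have h2 : HasDerivAt (fun s => (s, chartMap m c x)) ((1 : ℝ), (0 : EuclideanSpace ℝ (Fin m)))
        t := (hasDerivAt_id t).prodMk (hasDerivAt_const t _)
    refine (h1.comp_hasDerivAt t h2).congr_of_eventuallyEq (Filter.Eventually.of_forall fun s => ?_)
    exact dNormSq_eq_trace g h (F s) hx
  have hcoord : ∀ c : M, ContinuousOn (fun p : ℝ × M => (p.1, chartMap m c p.2))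
      (Ioo (-ε) ε ×ˢ (chartMap m c).source) := fun c =>
    continuousOn_fst.prodMk ((chartMap m c).continuousOn.comp continuousOn_snd fun p hp => hp.2)
  have hmaps : ∀ c : M, MapsTo (fun p : ℝ × M => (p.1, chartMap m c p.2))
      (Ioo (-ε) ε ×ˢ (chartMap m c).source) (Ioo (-ε) ε ×ˢ (chartMap m c).target) :=
    fun c p hp => ⟨hp.1, (chartMap m c).map_source hp.2⟩
  -- Continuity is local, so that it may be checked in one chart at a time.
  have hlocal : ∀ f : ℝ × M → ℝ,
      (∀ c, ContinuousOn f (Ioo (-ε) ε ×ˢ (chartMap m c).source)) →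
      ContinuousOn f (Ioo (-ε) ε ×ˢ univ) := by
    intro f hf p hp
    exact ((hf p.2).continuousAt ((isOpen_Ioo.prod (chartMap m p.2).open_source).mem_nhds
      ⟨hp.1, mem_chart_source (EuclideanSpace ℝ (Fin m)) p.2⟩)).continuousWithinAt
  refine ⟨fun t x => fderiv ℝ (D x) (t, chartMap m x x) (1, 0), hlocal _ fun c => ?_,
    hlocal _ fun c => ?_,
    fun t ht x => hderiv x t ht x (mem_chart_source (EuclideanSpace ℝ (Fin m)) x)⟩
  · have h1 : ContinuousOn (fun p => fderiv ℝ (D c) p (1, 0))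
        (Ioo (-ε) ε ×ˢ (chartMap m c).target) :=
      ((hD c).continuousOn_fderiv_of_isOpen (hopen c) (by simp)).clm_apply continuousOn_const
    refine (h1.comp (hcoord c) (hmaps c)).congr fun p hp => ?_
    exact (hderiv p.2 p.1 hp.1 p.2 (mem_chart_source _ p.2)).unique (hderiv c p.1 hp.1 p.2 hp.2)
  · exact ((hD c).continuousOn.comp (hcoord c) (hmaps c)).congr fun p hp =>
      dNormSq_eq_trace g h (F p.1) hp.2

end Smoothness

/-! ### The Riemannian volume -/

section Volume

variable {m : ℕ}
  {M : Type*} [TopologicalSpace M] [ChartedSpace (EuclideanSpace ℝ (Fin m)) M]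

theorem aemeasurable_chartMap_symm [MeasurableSpace M] [BorelSpace M] (c : M) :
    AEMeasurable (chartMap m c).symm (volume.restrict (chartMap m c).target) :=
  (chartMap m c).continuousOn_symm.aemeasurable (chartMap m c).open_target.measurableSet

theorem MeasureTheory.Measure.map_withDensity_comp {α β : Type*} [MeasurableSpace α]
    [MeasurableSpace β] {μ : Measure α} {f : α → β} (hf : AEMeasurable f μ) {ρ : β → ENNReal}
    (hρ : Measurable ρ) : (μ.withDensity (ρ ∘ f)).map f = (μ.map f).withDensity ρ := by
  have hf' : AEMeasurable f (μ.withDensity (ρ ∘ f)) :=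
    hf.mono_ac (withDensity_absolutelyContinuous μ _)
  ext s hs
  rw [Measure.map_apply_of_aemeasurable hf' hs, withDensity_apply _ hs,
    ← lintegral_indicator hs, lintegral_map' (hρ.indicator hs).aemeasurable hf,
    withDensity_apply₀ _ (hf.nullMeasurableSet_preimage hs),
    ← lintegral_indicator₀ (hf.nullMeasurableSet_preimage hs)]
  rfl

variable [IsManifold (𝓡 m) ∞ M]

theorem aemeasurable_volumeDensity (g : SmoothMetric m M) (c : M) :
    AEMeasurable (fun y => ENNReal.ofReal (Real.sqrt (metricMatrix g c y).det))
      (volume.restrict (chartMap m c).target) :=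
  ((contDiffOn_det (contDiffOn_metricMatrix g c)).continuousOn.sqrt.aemeasurable
    (chartMap m c).open_target.measurableSet).ennreal_ofReal

/-- The density of the volume in a chart is continuous, hence bounded on compact sets. -/
theorem chartVolume_lt_top_of_isCompact [T2Space M] [MeasurableSpace M] [BorelSpace M]
    (g : SmoothMetric m M) (c : M) {K : Set M} (hK : IsCompact K)
    (hKc : K ⊆ (chartMap m c).source) : chartVolume g c K < ⊤ := by
  have hms := (aemeasurable_chartMap_symm c).mono_ac
    (withDensity_absolutelyContinuous (volume.restrict (chartMap m c).target)
      fun y => ENNReal.ofReal (Real.sqrt (metricMatrix g c y).det))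
  have hK' : IsCompact (chartMap m c '' K) :=
    hK.image_of_continuousOn ((chartMap m c).continuousOn.mono hKc)
  have hKt : chartMap m c '' K ⊆ (chartMap m c).target := by
    rintro _ ⟨x, hx, rfl⟩
    exact (chartMap m c).map_source (hKc hx)
  have hpre : (chartMap m c).symm ⁻¹' K ∩ (chartMap m c).target ⊆ chartMap m c '' K :=
    fun y hy => ⟨_, hy.1, (chartMap m c).right_inv hy.2⟩
  have hcont : ContinuousOn (fun y => Real.sqrt (metricMatrix g c y).det) (chartMap m c).target :=
    (contDiffOn_det (contDiffOn_metricMatrix g c)).continuousOn.sqrt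
  obtain ⟨C, hC⟩ := hK'.exists_bound_of_continuousOn (hcont.mono hKt)
  have hnull : NullMeasurableSet ((chartMap m c).symm ⁻¹' K)
      (volume.restrict (chartMap m c).target) :=
    (aemeasurable_chartMap_symm c).nullMeasurableSet_preimage hK.measurableSet
  rw [chartVolume, Measure.map_apply_of_aemeasurable hms hK.measurableSet,
    withDensity_apply₀ _ hnull, Measure.restrict_restrict₀ hnull]
  calc _ ≤ ∫⁻ y in chartMap m c '' K,
        ENNReal.ofReal (Real.sqrt (metricMatrix g c y).det) := lintegral_mono_set hpre
    _ ≤ ∫⁻ _ in chartMap m c '' K, ENNReal.ofReal C :=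
        setLIntegral_mono measurable_const fun y hy =>
          ENNReal.ofReal_le_ofReal ((le_abs_self _).trans (hC y hy))
    _ < ⊤ := by
        rw [setLIntegral_const]
        exact ENNReal.mul_lt_top ENNReal.ofReal_lt_top hK'.measure_lt_top

/-- Only finitely many functions of the partition of unity are nonzero, and each has compact
support in its chart. -/
instance isFiniteMeasure_riemannianVolume [T2Space M] [CompactSpace M] [MeasurableSpace M]
    [BorelSpace M] (g : SmoothMetric m M) : IsFiniteMeasure (riemannianVolume g) := by
  refine ⟨?_⟩
  have hfin : {c : M | (Function.support (chartPartition m M c)).Nonempty}.Finite :=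
    (chartPartition m M).locallyFinite.finite_nonempty_of_compact
  have hzero : ∀ c ∉ hfin.toFinset, ((chartVolume g c).withDensity
      fun x => ENNReal.ofReal (chartPartition m M c x)) univ = 0 := by
    intro c hc
    have h0 : ∀ x, chartPartition m M c x = 0 := by
      intro x
      by_contra hx
      exact hc (hfin.mem_toFinset.2 ⟨x, hx⟩)
    simp [h0]
  rw [riemannianVolume, Measure.sum_apply _ MeasurableSet.univ, tsum_eq_sum hzero]
  refine ENNReal.sum_lt_top.2 fun c _ => ?_
  have hK : IsCompact (tsupport (chartPartition m M c)) := (isClosed_tsupport _).isCompact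
  have hle : ∀ x, ENNReal.ofReal (chartPartition m M c x) ≤
      (tsupport (chartPartition m M c)).indicator (fun _ => 1) x := by
    intro x
    by_cases hx : x ∈ tsupport (chartPartition m M c)
    · rw [indicator_of_mem hx]
      exact ENNReal.ofReal_le_one.2 ((chartPartition m M).le_one c x)
    · rw [image_eq_zero_of_notMem_tsupport hx]
      simp
  rw [withDensity_apply _ MeasurableSet.univ, Measure.restrict_univ]
  calc _ ≤ ∫⁻ x, (tsupport (chartPartition m M c)).indicator (fun _ => 1) x ∂(chartVolume g c) :=
        lintegral_mono hle
    _ = chartVolume g c (tsupport (chartPartition m M c)) := by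
        rw [lintegral_indicator hK.measurableSet, setLIntegral_one]
    _ < ⊤ := chartVolume_lt_top_of_isCompact g c hK (chartPartition_isSubordinate c)

end Volume

/-! ### Conformal change of the metric -/

section Conformal

variable {m n : ℕ}
  {M : Type*} [TopologicalSpace M] [ChartedSpace (EuclideanSpace ℝ (Fin m)) M]
  [IsManifold (𝓡 m) ∞ M]
  {N : Type*} [TopologicalSpace N] [ChartedSpace (EuclideanSpace ℝ (Fin n)) N]
  [IsManifold (𝓡 n) ∞ N]

set_option synthInstance.maxHeartbeats 200000 in
/-- The metric `μ² g`. -/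
noncomputable def conformalMetric (g : SmoothMetric m M) (μ : M → ℝ)
    (hμ : ContMDiff (𝓡 m) 𝓘(ℝ, ℝ) ∞ μ)
    (hpos : ∀ x, 0 < μ x) : SmoothMetric m M where
  inner x := μ x ^ 2 • g.inner x
  symm x v w := by
    simp only [smul_apply]
    rw [g.symm]
  pos x v hv := by
    simpa only [smul_apply, smul_eq_mul] using mul_pos (pow_pos (hpos x) 2) (g.pos x v hv)
  isVonNBounded x := by
    have hb : Bornology.IsVonNBounded ℝ {v : TangentSpace (𝓡 m) x | g.inner x v v < 1} :=
      g.isVonNBounded x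
    -- The unit ball of `μ² g` is the unit ball of `g` scaled by `μ⁻¹`.
    refine Bornology.IsVonNBounded.subset (fun v hv => ?_)
      (hb.image ((μ x)⁻¹ • ContinuousLinearMap.id ℝ (TangentSpace (𝓡 m) x)))
    refine ⟨μ x • v, ?_, ?_⟩
    · simp only [mem_ofPred_eq, smul_apply, map_smul, smul_eq_mul] at hv ⊢
      linarith
    · change (μ x)⁻¹ • μ x • v = v
      rw [smul_smul, inv_mul_cancel₀ (hpos x).ne', one_smul]
  contMDiff := (hμ.pow 2).smul_section g.contMDiff

theorem metricMatrix_conformal {g g' : SmoothMetric m M} {μ : M → ℝ}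
    (hg : ∀ (x : M) (v w : TangentSpace (𝓡 m) x), g'.inner x v w = μ x ^ 2 * g.inner x v w)
    (c : M) (y : EuclideanSpace ℝ (Fin m)) :
    metricMatrix g' c y = μ ((chartMap m c).symm y) ^ 2 • metricMatrix g c y := by
  ext i j
  simp [metricMatrix, hg]

/-- `|dψ|²` is multiplied by `μ⁻²` when `g` is replaced by `μ² g`. -/
theorem dNormSq_conformal {g g' : SmoothMetric m M} {μ : M → ℝ} (hpos : ∀ x, 0 < μ x)
    (hg : ∀ (x : M) (v w : TangentSpace (𝓡 m) x), g'.inner x v w = μ x ^ 2 * g.inner x v w)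
    (h : SmoothMetric n N) (ψ : M → N) (x : M) :
    dNormSq g' h ψ x = (μ x ^ 2)⁻¹ * dNormSq g h ψ x := by
  have hx : x ∈ (chartMap m x).source := mem_chart_source _ x
  have hdet : IsUnit (metricMatrix g x (chartMap m x x)).det :=
    (metricMatrix_det_pos g ((chartMap m x).map_source hx)).ne'.isUnit
  let _ : Invertible (μ x ^ 2) := invertibleOfNonzero (pow_ne_zero 2 (hpos x).ne')
  rw [dNormSq, dNormSq, metricMatrix_conformal hg, (chartMap m x).left_inv hx,
    Matrix.inv_smul _ _ hdet, invOf_eq_inv, Matrix.smul_mul, Matrix.trace_smul, smul_eq_mul]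

theorem chartVolume_conformal [MeasurableSpace M] [BorelSpace M] {g g' : SmoothMetric m M}
    {μ : M → ℝ} (hμ : Continuous μ) (hpos : ∀ x, 0 < μ x)
    (hg : ∀ (x : M) (v w : TangentSpace (𝓡 m) x), g'.inner x v w = μ x ^ 2 * g.inner x v w)
    (c : M) : chartVolume g' c =
      (chartVolume g c).withDensity fun x => ENNReal.ofReal (μ x ^ m) := by
  have hmeas : Measurable fun x => ENNReal.ofReal (μ x ^ m) :=
    (hμ.pow m).measurable.ennreal_ofReal
  have hms := (aemeasurable_chartMap_symm c).mono_ac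
    (withDensity_absolutelyContinuous (volume.restrict (chartMap m c).target)
      fun y => ENNReal.ofReal (Real.sqrt (metricMatrix g c y).det))
  have hdens : (fun y => ENNReal.ofReal (Real.sqrt (metricMatrix g' c y).det)) =
      (fun y => ENNReal.ofReal (Real.sqrt (metricMatrix g c y).det)) *
        ((fun x => ENNReal.ofReal (μ x ^ m)) ∘ (chartMap m c).symm) := by
    funext y
    have hm := pow_pos (hpos ((chartMap m c).symm y)) m
    simp only [Pi.mul_apply, Function.comp_apply]
    rw [metricMatrix_conformal hg, Matrix.det_smul, Fintype.card_fin, ← pow_mul, mul_comm 2 m,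
      pow_mul, Real.sqrt_mul (sq_nonneg _), Real.sqrt_sq hm.le, ENNReal.ofReal_mul hm.le, mul_comm]
  rw [chartVolume, chartVolume, ← Measure.map_withDensity_comp hms hmeas, hdens,
    withDensity_mul₀ (aemeasurable_volumeDensity g c)
      (hmeas.comp_aemeasurable (aemeasurable_chartMap_symm c))]

/-- `dV_{μ²g} = μᵐ dV_g`. -/
theorem riemannianVolume_conformal [T2Space M] [CompactSpace M] [MeasurableSpace M]
    [BorelSpace M] {g g' : SmoothMetric m M}
    {μ : M → ℝ} (hμ : Continuous μ) (hpos : ∀ x, 0 < μ x)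
    (hg : ∀ (x : M) (v w : TangentSpace (𝓡 m) x), g'.inner x v w = μ x ^ 2 * g.inner x v w) :
    riemannianVolume g' =
      (riemannianVolume g).withDensity fun x => ENNReal.ofReal (μ x ^ m) := by
  have hmeas : Measurable fun x => ENNReal.ofReal (μ x ^ m) :=
    (hμ.pow m).measurable.ennreal_ofReal
  rw [riemannianVolume, riemannianVolume, withDensity_sum]
  congr 1
  funext c
  have hρ : Measurable fun x => ENNReal.ofReal (chartPartition m M c x) :=
    (chartPartition m M c).contMDiff.continuous.measurable.ennreal_ofReal
  rw [chartVolume_conformal hμ hpos hg, ← withDensity_mul _ hmeas hρ, mul_comm,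
    withDensity_mul _ hρ hmeas]

theorem alphaEnergy_conformal [T2Space M] [CompactSpace M] [MeasurableSpace M]
    [BorelSpace M] {g g' : SmoothMetric m M}
    {μ : M → ℝ} (hμ : Continuous μ) (hpos : ∀ x, 0 < μ x)
    (hg : ∀ (x : M) (v w : TangentSpace (𝓡 m) x), g'.inner x v w = μ x ^ 2 * g.inner x v w)
    (α : ℝ) (h : SmoothMetric n N) (ψ : M → N) :
    alphaEnergy α g' h ψ =
      ∫ x, μ x ^ m * (1 + (μ x ^ 2)⁻¹ * dNormSq g h ψ x) ^ α ∂(riemannianVolume g) := by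
  have hmeas : Measurable fun x => ENNReal.ofReal (μ x ^ m) :=
    (hμ.pow m).measurable.ennreal_ofReal
  rw [alphaEnergy, riemannianVolume_conformal hμ hpos hg,
    integral_withDensity_eq_integral_toReal_smul hmeas
      (Filter.Eventually.of_forall fun x => ENNReal.ofReal_lt_top)]
  refine integral_congr_ae (Filter.Eventually.of_forall fun x => ?_)
  simp only
  rw [ENNReal.toReal_ofReal (pow_pos (hpos x) m).le, dNormSq_conformal hpos hg, smul_eq_mul]

end Conformal

/-! ### The conformal factor -/

/-- The function `u ↦ exp (-γ u) - exp u` has a smooth right inverse on the whole real line. -/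
theorem exists_contDiff_exp_sub_exp_eq {γ : ℝ} (hγ : 0 < γ) :
    ∃ Θ : ℝ → ℝ, ContDiff ℝ ∞ Θ ∧
      ∀ e, Real.exp (-(γ * Θ e)) - Real.exp (Θ e) = e := by
  -- The negative of the function is strictly increasing, with positive derivative.
  set f : ℝ → ℝ := fun u => Real.exp u - Real.exp (-(γ * u)) with hf
  have hmono : StrictMono f := by
    intro a b hab
    have h1 : Real.exp a < Real.exp b := Real.exp_lt_exp.2 hab
    have h2 : Real.exp (-(γ * b)) < Real.exp (-(γ * a)) := Real.exp_lt_exp.2 (by nlinarith)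
    simp only [hf]
    linarith
  have hsmooth : ContDiff ℝ ∞ f :=
    Real.contDiff_exp.sub (Real.contDiff_exp.comp (contDiff_const.mul contDiff_id).neg)
  have htop : Filter.Tendsto f Filter.atTop Filter.atTop := by
    refine Filter.tendsto_atTop_mono' _ ?_
      (Filter.tendsto_atTop_add_const_right _ (-1) Real.tendsto_exp_atTop)
    filter_upwards [Filter.eventually_ge_atTop 0] with u hu
    have : Real.exp (-(γ * u)) ≤ 1 := Real.exp_le_one_iff.2 (by nlinarith)
    simp only [hf]
    linarith
  have hbot : Filter.Tendsto f Filter.atBot Filter.atBot := by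
    have h1 : Filter.Tendsto (fun u : ℝ => -Real.exp (-(γ * u)) + 1) Filter.atBot Filter.atBot := by
      refine Filter.tendsto_atBot_add_const_right _ _ (Filter.tendsto_neg_atTop_atBot.comp
        (Real.tendsto_exp_atTop.comp (Filter.tendsto_neg_atBot_atTop.comp ?_)))
      exact Filter.Tendsto.const_mul_atBot hγ Filter.tendsto_id
    refine Filter.tendsto_atBot_mono' _ ?_ h1
    filter_upwards [Filter.eventually_le_atBot 0] with u hu
    have : Real.exp u ≤ 1 := Real.exp_le_one_iff.2 hu
    simp only [hf]
    linarith
  let H : ℝ ≃ₜ ℝ :=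
    (hmono.orderIsoOfSurjective f (hsmooth.continuous.surjective htop hbot)).toHomeomorph
  have hderiv : ∀ u, HasDerivAt H (Real.exp u + γ * Real.exp (-(γ * u))) u := by
    intro u
    have h1 : HasDerivAt (fun u => -(γ * u)) (-(γ * 1)) u :=
      ((hasDerivAt_id u).const_mul γ).neg
    exact ((Real.hasDerivAt_exp u).sub h1.exp).congr_deriv (by ring)
  have hinv : ContDiff ℝ ∞ H.symm :=
    H.contDiff_symm_deriv (fun u => (by positivity)) hderiv hsmooth
  refine ⟨fun e => H.symm (-e), hinv.comp contDiff_neg, fun e => ?_⟩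
  have h1 : f (H.symm (-e)) = -e := H.apply_symm_apply (-e)
  simp only [hf] at h1
  linarith

/-- There is a smooth positive function `μ` of the energy density `e` with
`μ^(m-2) (1 + e/μ²)^(α-1) = 1`. -/
theorem exists_conformalFactor {m : ℕ} {α : ℝ} (hα : 1 < α) (hm : 2 * α < (m : ℝ)) :
    ∃ μ : ℝ → ℝ, ContDiff ℝ ∞ μ ∧ (∀ e, 0 < μ e) ∧
      ∀ e, μ e ^ m * ((μ e ^ 2)⁻¹ * (1 + (μ e ^ 2)⁻¹ * e) ^ (α - 1)) = 1 := by
  set γ : ℝ := ((m : ℝ) - 2 * α) / (2 * (α - 1)) with hγ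
  have hα' : 0 < α - 1 := by linarith
  obtain ⟨Θ, hΘ, hΘe⟩ := exists_contDiff_exp_sub_exp_eq (γ := γ)
    (div_pos (by linarith) (by linarith))
  refine ⟨fun e => Real.exp (Θ e / 2), Real.contDiff_exp.comp (hΘ.div_const 2),
    fun e => Real.exp_pos _, fun e => ?_⟩
  have h1 : (Real.exp (Θ e / 2) ^ 2)⁻¹ = Real.exp (-Θ e) := by
    rw [← Real.exp_nat_mul, ← Real.exp_neg]
    congr 1
    push_cast
    ring
  have h2 : 1 + Real.exp (-Θ e) * e = Real.exp (-((γ + 1) * Θ e)) := by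
    nth_rewrite 2 [← hΘe e]
    rw [mul_sub, ← Real.exp_add, ← Real.exp_add, neg_add_cancel, Real.exp_zero,
      add_sub_cancel]
    congr 1
    ring
  have h3 : (γ + 1) * (α - 1) = m / 2 - 1 := by
    rw [hγ]
    field_simp
    ring
  simp only
  rw [h1, h2, ← Real.exp_mul, ← Real.exp_nat_mul, ← Real.exp_add, ← Real.exp_add,
    Real.exp_eq_one_iff]
  linear_combination (-Θ e) * h3

/-! ### The first variation -/

/-- Differentiation under the integral sign on a compact space: the derivative is bounded on
`[-ε/2, ε/2] × X`, and this bound is the dominating function. -/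
theorem hasDerivAt_integral_of_continuousOn {X : Type*} [TopologicalSpace X] [CompactSpace X]
    [MeasurableSpace X] [BorelSpace X] (ν : Measure X) [IsFiniteMeasure ν] {ε : ℝ} (hε : 0 < ε)
    {f f' : ℝ → X → ℝ}
    (hf : ContinuousOn (fun p : ℝ × X => f p.1 p.2) (Ioo (-ε) ε ×ˢ univ))
    (hf' : ContinuousOn (fun p : ℝ × X => f' p.1 p.2) (Ioo (-ε) ε ×ˢ univ))
    (hd : ∀ t ∈ Ioo (-ε) ε, ∀ x, HasDerivAt (fun s => f s x) (f' t x) t) :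
    HasDerivAt (fun t => ∫ x, f t x ∂ν) (∫ x, f' 0 x ∂ν) 0 := by
  have hslice : ∀ {k : ℝ → X → ℝ}, ContinuousOn (fun p : ℝ × X => k p.1 p.2)
      (Ioo (-ε) ε ×ˢ univ) → ∀ t ∈ Ioo (-ε) ε, Continuous (k t) := by
    intro k hk t ht
    rw [← continuousOn_univ]
    exact hk.comp (f := fun x : X => (t, x)) (by fun_prop) fun x _ => ⟨ht, mem_univ _⟩
  have h0 : (0 : ℝ) ∈ Ioo (-ε) ε := ⟨by linarith, hε⟩
  have hsub : Icc (-(ε / 2)) (ε / 2) ⊆ Ioo (-ε) ε := fun t ht =>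
    ⟨by linarith [ht.1], by linarith [ht.2]⟩
  obtain ⟨C, hC⟩ := (isCompact_Icc.prod isCompact_univ).exists_bound_of_continuousOn
    (hf'.mono (prod_mono hsub (subset_refl univ)))
  refine (hasDerivAt_integral_of_dominated_loc_of_deriv_le (bound := fun _ => C)
    (Icc_mem_nhds (a := -(ε / 2)) (b := ε / 2) (by linarith) (by linarith)) ?_ ?_ ?_ ?_
    (integrable_const C) ?_).2
  · filter_upwards [Ioo_mem_nhds h0.1 h0.2] with t ht
    exact (hslice hf t ht).aestronglyMeasurable
  · exact (hslice hf 0 h0).integrable_of_hasCompactSupport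
      (HasCompactSupport.of_compactSpace _)
  · exact (hslice hf' 0 h0).aestronglyMeasurable
  · exact Filter.Eventually.of_forall fun x t ht => hC (t, x) ⟨ht, mem_univ _⟩
  · exact Filter.Eventually.of_forall fun x t ht => hd t (hsub ht) x

theorem mainTheorem4 {m n : ℕ}
    {M : Type*} [TopologicalSpace M] [ChartedSpace (EuclideanSpace ℝ (Fin m)) M]
    [IsManifold (𝓡 m) ∞ M] [T2Space M] [CompactSpace M] [MeasurableSpace M] [BorelSpace M]
    {N : Type*} [TopologicalSpace N] [ChartedSpace (EuclideanSpace ℝ (Fin n)) N]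
    [IsManifold (𝓡 n) ∞ N] [T2Space N] [SecondCountableTopology N]
    (α : ℝ) (hα : 1 < α) (hm : 2 * α < (m : ℝ))
    (g : SmoothMetric m M) (h : SmoothMetric n N)
    (ψ : M → N) (hψ : IsHarmonicMap g h ψ) :
    ∃ g' : SmoothMetric m M, ConformallyEquivalent g g' ∧ IsAlphaHarmonicMap α g' h ψ := by
  obtain ⟨k, hk, hkpos, hkeq⟩ := exists_conformalFactor hα hm
  set μ : M → ℝ := fun x => k (dNormSq g h ψ x)
  have hμ : ContMDiff (𝓡 m) 𝓘(ℝ, ℝ) ∞ μ := hk.contMDiff.comp (contMDiff_dNormSq g h hψ.1)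
  have hpos : ∀ x, 0 < μ x := fun x => hkpos _
  have hconf : ∀ (x : M) (v w : TangentSpace (𝓡 m) x),
      (conformalMetric g μ hμ hpos).inner x v w = μ x ^ 2 * g.inner x v w := fun x v w => rfl
  refine ⟨conformalMetric g μ hμ hpos, ⟨μ, hμ, hpos, hconf⟩, hψ.1, fun ε F hε hF => ?_⟩
  simp only [alphaEnergy_conformal hμ.continuous hpos hconf]
  obtain ⟨e', he', he, hd⟩ := hF.exists_hasDerivAt_dNormSq g h
  have hstat : ∫ x, e' 0 x ∂(riemannianVolume g) = 0 := by
    have h1 := (hasDerivAt_integral_of_continuousOn (riemannianVolume g) hε he he' hd).const_mul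
      (1 / 2 : ℝ)
    have h2 := h1.unique (hψ.2 ε F hε hF)
    linarith
  have hμfst : Continuous fun p : ℝ × M => μ p.2 := hμ.continuous.comp continuous_snd
  have hμinv : Continuous fun p : ℝ × M => (μ p.2 ^ 2)⁻¹ :=
    (hμfst.pow 2).inv₀ fun p => pow_ne_zero 2 (hpos p.2).ne'
  have hbase : ContinuousOn (fun p : ℝ × M => 1 + (μ p.2 ^ 2)⁻¹ * dNormSq g h (F p.1) p.2)
      (Ioo (-ε) ε ×ˢ univ) := continuousOn_const.add (hμinv.continuousOn.mul he)
  have key := hasDerivAt_integral_of_continuousOn (riemannianVolume g) hε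
    (f := fun t x => μ x ^ m * (1 + (μ x ^ 2)⁻¹ * dNormSq g h (F t) x) ^ α)
    (f' := fun t x => μ x ^ m * ((μ x ^ 2)⁻¹ * e' t x * α *
      (1 + (μ x ^ 2)⁻¹ * dNormSq g h (F t) x) ^ (α - 1)))
    ((hμfst.pow m).continuousOn.mul (hbase.rpow_const fun p _ => Or.inr (by linarith)))
    ((hμfst.pow m).continuousOn.mul (((hμinv.continuousOn.mul he').mul continuousOn_const).mul
      (hbase.rpow_const fun p _ => Or.inr (by linarith))))
    fun t ht x => ((((hd t ht x).const_mul _).const_add 1).rpow_const (Or.inr hα.le)).const_mul _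
  refine key.congr_deriv ?_
  -- By the choice of `μ` the weight of `e' 0` in the integrand is the constant `α`.
  have hint : ∀ x, μ x ^ m * ((μ x ^ 2)⁻¹ * e' 0 x * α *
      (1 + (μ x ^ 2)⁻¹ * dNormSq g h (F 0) x) ^ (α - 1)) = α * e' 0 x := by
    intro x
    rw [hF.1]
    linear_combination (α * e' 0 x) * hkeq (dNormSq g h ψ x)
  simp only [hint]
  rw [integral_const_mul, hstat, mul_zero]
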